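/- For a finite family $\mathcal{F}$ of subsets of $[n]=\{1,\dots,n\}$ and a set $X\subseteq[n]$, put $\mathcal{F}(X)=\{F\setminus X : F\in\mathcal{F},\ X\subseteq F\}$. For a real number $R>0$, a family $\mathcal{F}$ is called $R$-spread if it is nonempty and $|\mathcal{F}(X)|\le R^{-|X|}\,|\mathcal{F}|$ for every $X\subseteq[n]$. A family is $\ell$-uniform if all its sets have exactly $\ell$ elements. Proposition. Let $n,s,k$ be nonnegative integers with $k\ge 2$, and let $R$ be a real number with $R>2^{13}\,s\,\lceil\log_2 k\rceil$. Let $\mathcal{G}_1,\dots,\mathcal{G}_s$ be $R$-spread families of subsets of $[n]$ such that, for each $i$, the family $\mathcal{G}_i$ is $k_i$-uniform for some $k_i\le k$. Then there exist pairwise disjoint sets $F_1\in\mathcal{G}_1,\dots,F_s\in\mathcal{G}_s$. -/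

import Mathlib

/-- `𝓕(A, B) = {F \ B | F ∈ 𝓕, F ∩ B = A}`. -/
def restrictFamily {n : ℕ} (𝓕 : Finset (Finset (Fin n))) (A B : Finset (Fin n)) :
    Finset (Finset (Fin n)) :=
  (𝓕.filter (fun F => F ∩ B = A)).image (fun F => F \ B)

/-- `𝓕(B) = 𝓕(B, B)`: the sets `F \ B` for those `F ∈ 𝓕` that contain `B`. -/
def linkFamily {n : ℕ} (𝓕 : Finset (Finset (Fin n))) (B : Finset (Fin n)) :
    Finset (Finset (Fin n)) :=
  restrictFamily 𝓕 B B

/-- A family is `R`-spread if it is nonempty (so that sampling uniformly from it makes sense) and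
`|𝓕(X)| ≤ R ^ (-|X|) * |𝓕|` for every subset `X` of the ground set. -/
def IsSpreadFamily {n : ℕ} (R : ℝ) (𝓕 : Finset (Finset (Fin n))) : Prop :=
  𝓕.Nonempty ∧ ∀ X : Finset (Fin n),
    ((linkFamily 𝓕 X).card : ℝ) ≤ R ^ (-(X.card : ℤ)) * (𝓕.card : ℝ)

/-- All sets of the family have size exactly `k`. -/
def IsUniformFamily {n : ℕ} (k : ℕ) (𝓕 : Finset (Finset (Fin n))) : Prop :=
  ∀ F ∈ 𝓕, F.card = k

/-! Split the ground set at random into `2s` parts. Each part is a random set of density `1/(2s)`,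
which contains no member of a given `G i` with probability at most `1/8`. The parts are dependent,
but for products of antitone functions no worse than independent sets
(`exists_disjoint_sum_prod_le`). A union bound over `i` and over all choices of `s + 1` parts then
gives a partition in which each `G i` has members inside at least `s` parts, and Hall's theorem
assigns distinct parts.

The bound `1/8` rests on `card_mul_biasedMean_avoids_le`, which exposes the random set in about
`log₂ k` rounds. After a round `W`, each `F i` is replaced by a smallest fragment `T = F j \ W` with
`F j ⊆ F i ∪ W`. Few fragments exceed half the size bound (`biasedMean_card_large_fragment_le`):
given `Z = W ∪ T`, minimality puts `T` inside one member chosen from `Z` alone, so `T` has at most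
`2 ^ k` values, and spreadness limits the `i` with `T ⊆ F i`. Large fragments are discarded; the
others lie in the sets they replace and so inherit the spread bound. -/

/-- The mean of `φ` over a random subset of `U` that contains each element independently with
probability `p`. -/
noncomputable def biasedMean {α : Type*} [DecidableEq α] (p : ℝ) (U : Finset α)
    (φ : Finset α → ℝ) : ℝ :=
  ∑ W ∈ U.powerset, p ^ W.card * (1 - p) ^ (U \ W).card * φ W

/-! ### Means over random subsets -/

section BiasedMean

variable {α : Type*} [DecidableEq α]

theorem biasedMean_empty (p : ℝ) (φ : Finset α → ℝ) : biasedMean p ∅ φ = φ ∅ := by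
  simp [biasedMean]

theorem biasedMean_add (p : ℝ) (U : Finset α) (φ ψ : Finset α → ℝ) :
    biasedMean p U (fun W => φ W + ψ W) = biasedMean p U φ + biasedMean p U ψ := by
  simp only [biasedMean, mul_add, Finset.sum_add_distrib]

theorem biasedMean_mul_left (p c : ℝ) (U : Finset α) (φ : Finset α → ℝ) :
    biasedMean p U (fun W => c * φ W) = c * biasedMean p U φ := by
  simp only [biasedMean, Finset.mul_sum]
  exact Finset.sum_congr rfl fun W _ => by ring

theorem biasedMean_mono {p : ℝ} (h0 : 0 ≤ p) (h1 : p ≤ 1) {U : Finset α} {φ ψ : Finset α → ℝ}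
    (h : ∀ W ⊆ U, φ W ≤ ψ W) : biasedMean p U φ ≤ biasedMean p U ψ := by
  have h2 : 0 ≤ 1 - p := by linarith
  refine Finset.sum_le_sum fun W hW => mul_le_mul_of_nonneg_left (h W (Finset.mem_powerset.1 hW)) ?_
  positivity

theorem biasedMean_insert (p : ℝ) {U : Finset α} {a : α} (ha : a ∉ U) (φ : Finset α → ℝ) :
    biasedMean p (insert a U) φ =
      biasedMean p U (fun W => p * φ (insert a W) + (1 - p) * φ W) := by
  rw [biasedMean, Finset.sum_powerset_insert ha, biasedMean, ← Finset.sum_add_distrib]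
  refine Finset.sum_congr rfl fun W hW => ?_
  have hWU := Finset.mem_powerset.1 hW
  have haW : a ∉ W := fun h => ha (hWU h)
  rw [Finset.insert_sdiff_of_notMem _ haW, Finset.card_insert_of_notMem haW,
    Finset.card_insert_of_notMem (fun h => ha (Finset.mem_sdiff.1 h).1)]
  have : insert a U \ insert a W = U \ W := by
    ext x
    simp only [Finset.mem_sdiff, Finset.mem_insert]
    constructor
    · rintro ⟨h | h, h'⟩ <;> tauto
    · rintro ⟨h, h'⟩
      refine ⟨Or.inr h, ?_⟩
      rintro (rfl | h2)
      · exact ha h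
      · exact h' h2
  rw [this]
  ring

theorem biasedMean_const (p c : ℝ) (U : Finset α) : biasedMean p U (fun _ => c) = c := by
  induction U using Finset.induction_on with
  | empty => rw [biasedMean_empty]
  | insert a U ha ih =>
    rw [biasedMean_insert p ha]
    convert ih using 2
    ext
    ring

theorem antitone_insert {φ : Finset α → ℝ} (hφ : Antitone φ) (a : α) :
    Antitone fun W => φ (insert a W) :=
  fun _ _ h => hφ (Finset.insert_subset_insert a h)

theorem antitone_mix {p : ℝ} (h0 : 0 ≤ p) (h1 : p ≤ 1) {φ : Finset α → ℝ} (hφ : Antitone φ)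
    (a : α) : Antitone fun W => p * φ (insert a W) + (1 - p) * φ W := by
  intro V W h
  have h2 : 0 ≤ 1 - p := by linarith
  exact add_le_add (mul_le_mul_of_nonneg_left (antitone_insert hφ a h) h0)
    (mul_le_mul_of_nonneg_left (hφ h) h2)

/-- A `p`-random set together with an independent `q`-random set dominates a `(p + q)`-random set
from below. -/
theorem biasedMean_add_le_union {p q : ℝ} (hp : 0 ≤ p) (hq : 0 ≤ q) (hpq : p + q ≤ 1)
    (U : Finset α) {φ : Finset α → ℝ} (hφ : Antitone φ) :
    biasedMean (p + q) U φ ≤ biasedMean p U fun W => biasedMean q U fun V => φ (W ∪ V) := by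
  induction U using Finset.induction_on generalizing φ with
  | empty => simp [biasedMean_empty]
  | insert a U ha ih =>
    have hpq0 : 0 ≤ p * q := mul_nonneg hp hq
    have hr0 : 0 ≤ p + q - p * q := by nlinarith
    have hr1 : p + q - p * q ≤ 1 := by nlinarith
    rw [biasedMean_insert _ ha, biasedMean_insert _ ha]
    -- The union contains `a` with probability only `p + q - p * q`; antitonicity absorbs the
    -- difference from `p + q`.
    calc _ ≤ biasedMean (p + q) U
          (fun W => (p + q - p * q) * φ (insert a W) + (1 - (p + q - p * q)) * φ W) := by
          refine biasedMean_mono (by linarith) hpq fun W _ => ?_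
          have := hφ (Finset.subset_insert a W)
          nlinarith
      _ ≤ _ := ih (antitone_mix hr0 hr1 hφ a)
      _ = _ := by
          congr 1
          ext W
          rw [biasedMean_insert _ ha, biasedMean_insert _ ha, ← biasedMean_mul_left,
            ← biasedMean_mul_left, ← biasedMean_add]
          congr 1
          ext V
          simp only [Finset.insert_union, Finset.union_insert, Finset.insert_idem]
          ring

end BiasedMean

/-! ### Minimal fragments and the spread lemma -/

section Fragments

variable {α ι : Type*} [DecidableEq α]

/-- The indicator that `W` contains no member of the family. -/
noncomputable def avoids (A : Finset ι) (F : ι → Finset α) (W : Finset α) : ℝ :=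
  if ∃ i ∈ A, F i ⊆ W then 0 else 1

theorem avoids_nonneg (A : Finset ι) (F : ι → Finset α) (W : Finset α) : 0 ≤ avoids A F W := by
  unfold avoids
  split_ifs <;> norm_num

theorem avoids_le_one (A : Finset ι) (F : ι → Finset α) (W : Finset α) : avoids A F W ≤ 1 := by
  unfold avoids
  split_ifs <;> norm_num

theorem antitone_avoids (A : Finset ι) (F : ι → Finset α) : Antitone (avoids A F) := by
  intro V W h
  by_cases hV : ∃ i ∈ A, F i ⊆ V
  · obtain ⟨i, hi, hiV⟩ := hV
    have : avoids A F W = 0 := if_pos ⟨i, hi, hiV.trans h⟩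
    rw [this]
    exact avoids_nonneg A F V
  · have : avoids A F V = 1 := if_neg hV
    rw [this]
    exact avoids_le_one A F W

/-- Every `F i` has a smallest possible fragment `F j \ W` with `F j ⊆ F i ∪ W`. -/
theorem exists_minimal_fragment (A : Finset ι) (F : ι → Finset α) :
    ∃ g : Finset α → ι → ι, ∀ W, ∀ i ∈ A, g W i ∈ A ∧ F (g W i) ⊆ F i ∪ W ∧
      ∀ j ∈ A, F j ⊆ F i ∪ W → (F (g W i) \ W).card ≤ (F j \ W).card := by
  have h : ∀ (W : Finset α) (i : ι), ∃ j, i ∈ A → j ∈ A ∧ F j ⊆ F i ∪ W ∧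
      ∀ l ∈ A, F l ⊆ F i ∪ W → (F j \ W).card ≤ (F l \ W).card := by
    intro W i
    by_cases hi : i ∈ A
    · obtain ⟨j, hj, hmin⟩ := Finset.exists_min_image (A.filter fun l => F l ⊆ F i ∪ W)
        (fun l => (F l \ W).card) ⟨i, by simp [hi]⟩
      rw [Finset.mem_filter] at hj
      exact ⟨j, fun _ => ⟨hj.1, hj.2, fun l hl hl' =>
        hmin l (Finset.mem_filter.2 ⟨hl, hl'⟩)⟩⟩
    · exact ⟨i, fun h => absurd h hi⟩
  choose g hg using h
  exact ⟨g, hg⟩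

theorem biased_weight_le {p : ℝ} (h0 : 0 < p) (h1 : p ≤ 1) (U : Finset α)
    {W T : Finset α} (hd : Disjoint W T) :
    p ^ W.card * (1 - p) ^ (U \ W).card ≤
      p ^ (W ∪ T).card * (1 - p) ^ (U \ (W ∪ T)).card * (p ^ T.card)⁻¹ := by
  have h2 : 0 ≤ 1 - p := by linarith
  rw [Finset.card_union_of_disjoint hd, pow_add]
  have h3 : p ^ T.card ≠ 0 := by positivity
  have h4 : p ^ W.card * p ^ T.card * (1 - p) ^ (U \ (W ∪ T)).card * (p ^ T.card)⁻¹ =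
      p ^ W.card * (1 - p) ^ (U \ (W ∪ T)).card := by
    field_simp
  rw [h4]
  refine mul_le_mul_of_nonneg_left (pow_le_pow_of_le_one h2 (by linarith) ?_) (by positivity)
  exact Finset.card_le_card (Finset.sdiff_subset_sdiff le_rfl Finset.subset_union_left)

/-- The expected number of indices whose minimal fragment is large. -/
theorem biasedMean_card_large_fragment_le {p R N : ℝ} {k j : ℕ} (h0 : 0 < p) (h1 : p ≤ 1)
    (hR : 1 ≤ p * R) {U : Finset α} {A : Finset ι} {F : ι → Finset α}
    (hU : ∀ i ∈ A, F i ⊆ U) (hk : ∀ i ∈ A, (F i).card ≤ k)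
    (hsp : ∀ X : Finset α, ((A.filter fun i => X ⊆ F i).card : ℝ) * R ^ X.card ≤ N)
    {g : Finset α → ι → ι} (hg : ∀ W, ∀ i ∈ A, g W i ∈ A ∧ F (g W i) ⊆ F i ∪ W ∧
      ∀ l ∈ A, F l ⊆ F i ∪ W → (F (g W i) \ W).card ≤ (F l \ W).card) :
    biasedMean p U (fun W => ((A.filter fun i => j ≤ (F (g W i) \ W).card).card : ℝ)) ≤
      2 ^ k * ((p * R) ^ j)⁻¹ * N := by
  classical
  have h2 : 0 ≤ 1 - p := by linarith
  have hR0 : 0 < R := by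
    by_contra h
    nlinarith
  have hN : 0 ≤ N := by
    have := hsp ∅
    simp only [Finset.empty_subset, Finset.card_empty, pow_zero, mul_one] at this
    exact le_trans (by positivity) this
  -- `c Z` must depend on `Z` alone, so that knowing `Z` confines the fragment to at most `2 ^ k`
  -- sets.
  obtain ⟨c, hc, hcU⟩ : ∃ c : Finset α → Finset α, (∀ Z, (∃ i ∈ A, F i ⊆ Z) →
      ∃ i ∈ A, F i = c Z ∧ F i ⊆ Z) ∧ ∀ Z, (c Z).card ≤ k := by
    have : ∀ Z, ∃ C : Finset α, ((∃ i ∈ A, F i ⊆ Z) → ∃ i ∈ A, F i = C ∧ F i ⊆ Z) ∧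
        C.card ≤ k := by
      intro Z
      by_cases hZ : ∃ i ∈ A, F i ⊆ Z
      · obtain ⟨i, hi, hiZ⟩ := hZ
        exact ⟨F i, fun _ => ⟨i, hi, rfl, hiZ⟩, hk i hi⟩
      · exact ⟨∅, fun h => absurd h hZ, by simp⟩
    choose c hc using this
    exact ⟨c, fun Z => (hc Z).1, fun Z => (hc Z).2⟩
  set w : Finset α → ℝ := fun W => p ^ W.card * (1 - p) ^ (U \ W).card with hw
  have hw0 : ∀ W, 0 ≤ w W := fun W => by simp only [hw]; positivity
  let S : Finset ((_ : Finset α) × Finset α) :=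
    U.powerset.sigma fun Z => (c Z).powerset.filter fun T => j ≤ T.card
  have key : ∀ i ∈ A, ∑ W ∈ U.powerset, (if j ≤ (F (g W i) \ W).card then w W else 0) ≤
      ∑ z ∈ S, if z.2 ⊆ F i then w z.1 * (p ^ z.2.card)⁻¹ else 0 := by
    intro i hi
    rw [← Finset.sum_filter, ← Finset.sum_filter]
    -- `W` is recovered from the pair `(Z, T)` as `Z \ T`.
    let e : Finset α → (_ : Finset α) × Finset α :=
      fun W => ⟨W ∪ (F (g W i) \ W), F (g W i) \ W⟩
    have he : Function.Injective e := by
      intro W W' h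
      simp only [e, Sigma.mk.injEq, heq_eq_eq] at h
      have h3 : ∀ V : Finset α, (V ∪ (F (g V i) \ V)) \ (F (g V i) \ V) = V := by
        intro V
        ext x
        simp only [Finset.mem_sdiff, Finset.mem_union]
        tauto
      rw [← h3 W, h.1, h.2, h3 W']
    calc _ ≤ ∑ W ∈ U.powerset.filter (fun W => j ≤ (F (g W i) \ W).card),
            w (e W).1 * (p ^ (e W).2.card)⁻¹ := by
          refine Finset.sum_le_sum fun W _ => ?_
          exact biased_weight_le h0 h1 U Finset.disjoint_sdiff
      _ = ∑ z ∈ (U.powerset.filter (fun W => j ≤ (F (g W i) \ W).card)).image e,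
            w z.1 * (p ^ z.2.card)⁻¹ := by
          rw [Finset.sum_image he.injOn]
      _ ≤ _ := by
          refine Finset.sum_le_sum_of_subset_of_nonneg ?_
            fun z _ _ => mul_nonneg (hw0 _) (by positivity)
          intro z hz
          obtain ⟨W, hW, rfl⟩ := Finset.mem_image.1 hz
          rw [Finset.mem_filter, Finset.mem_powerset] at hW
          obtain ⟨hWU, hj⟩ := hW
          obtain ⟨hgA, hgi, hmin⟩ := hg W i hi
          have hsub : F (g W i) ⊆ W ∪ (F (g W i) \ W) := by
            rw [Finset.union_sdiff_self_eq_union]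
            exact Finset.subset_union_right
          have hTi : F (g W i) \ W ⊆ F i := by
            intro x hx
            rw [Finset.mem_sdiff] at hx
            rcases Finset.mem_union.1 (hgi hx.1) with h | h
            · exact h
            · exact absurd h hx.2
          -- The member `c Z` competes with the minimal fragment: its part outside `W` lies in `T`,
          -- so minimality forces equality and `T ⊆ c Z`.
          obtain ⟨l, hl, hlc, hlZ⟩ := hc _ ⟨_, hgA, hsub⟩
          have hlT : F l \ W ⊆ F (g W i) \ W := by
            intro x hx
            rw [Finset.mem_sdiff] at hx
            rcases Finset.mem_union.1 (hlZ hx.1) with h | h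
            · exact absurd h hx.2
            · exact h
          have hli : F l ⊆ F i ∪ W := by
            intro x hx
            rcases Finset.mem_union.1 (hlZ hx) with h | h
            · exact Finset.mem_union_right _ h
            · exact Finset.mem_union_left _ (hTi h)
          have heq := Finset.eq_of_subset_of_card_le hlT (hmin l hl hli)
          simp only [S, e, Finset.mem_filter, Finset.mem_sigma, Finset.mem_powerset]
          refine ⟨⟨Finset.union_subset hWU (Finset.sdiff_subset.trans (hU _ hgA)), ?_, hj⟩, hTi⟩
          rw [← hlc, ← heq]
          exact Finset.sdiff_subset
  calc _ = ∑ i ∈ A, ∑ W ∈ U.powerset, (if j ≤ (F (g W i) \ W).card then w W else 0) := by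
        rw [Finset.sum_comm]
        refine Finset.sum_congr rfl fun W _ => ?_
        rw [← Finset.sum_filter, Finset.sum_const, nsmul_eq_mul, mul_comm]
    _ ≤ ∑ i ∈ A, ∑ z ∈ S, if z.2 ⊆ F i then w z.1 * (p ^ z.2.card)⁻¹ else 0 :=
        Finset.sum_le_sum key
    _ = ∑ z ∈ S, ((A.filter fun i => z.2 ⊆ F i).card : ℝ) * (w z.1 * (p ^ z.2.card)⁻¹) := by
        rw [Finset.sum_comm]
        refine Finset.sum_congr rfl fun z _ => ?_
        rw [← Finset.sum_filter, Finset.sum_const, nsmul_eq_mul]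
    _ ≤ ∑ z ∈ S, w z.1 * (((p * R) ^ j)⁻¹ * N) := by
        refine Finset.sum_le_sum fun z hz => ?_
        simp only [S, Finset.mem_filter, Finset.mem_sigma] at hz
        have h3 : ((A.filter fun i => z.2 ⊆ F i).card : ℝ) * (p ^ z.2.card)⁻¹ ≤
            ((p * R) ^ z.2.card)⁻¹ * N := by
          have h4 := hsp z.2
          rw [← le_div_iff₀ (by positivity)] at h4
          rw [mul_pow, mul_inv]
          calc _ ≤ N / R ^ z.2.card * (p ^ z.2.card)⁻¹ :=
                mul_le_mul_of_nonneg_right h4 (by positivity)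
            _ = _ := by ring
        have h5 : ((p * R) ^ z.2.card)⁻¹ ≤ ((p * R) ^ j)⁻¹ :=
          inv_anti₀ (by positivity) (pow_le_pow_right₀ hR hz.2.2)
        calc _ = w z.1 * (((A.filter fun i => z.2 ⊆ F i).card : ℝ) * (p ^ z.2.card)⁻¹) := by ring
          _ ≤ _ := mul_le_mul_of_nonneg_left
            (h3.trans (mul_le_mul_of_nonneg_right h5 hN)) (hw0 _)
    _ = ∑ Z ∈ U.powerset, w Z * ((((c Z).powerset.filter fun T => j ≤ T.card).card : ℝ) *
          (((p * R) ^ j)⁻¹ * N)) := by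
        rw [Finset.sum_sigma]
        refine Finset.sum_congr rfl fun Z _ => ?_
        simp only [Finset.sum_const, nsmul_eq_mul]
        ring
    _ ≤ biasedMean p U fun _ => 2 ^ k * ((p * R) ^ j)⁻¹ * N := by
        refine Finset.sum_le_sum fun Z _ => mul_le_mul_of_nonneg_left ?_ (hw0 Z)
        rw [mul_assoc]
        refine mul_le_mul_of_nonneg_right ?_ (by positivity)
        calc (((c Z).powerset.filter fun T => j ≤ T.card).card : ℝ)
            ≤ ((c Z).powerset.card : ℝ) := by exact_mod_cast Finset.card_filter_le _ _
          _ = 2 ^ (c Z).card := by rw [Finset.card_powerset]; push_cast; rfl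
          _ ≤ 2 ^ k := pow_le_pow_right₀ (by norm_num) (hcU Z)
    _ = _ := biasedMean_const _ _ _

/-- A spread family of sets with fewer than `2 ^ r` elements is rarely avoided by the union of `r`
random sets of density `p`. -/
theorem card_mul_biasedMean_avoids_le {p R N : ℝ} (h0 : 0 < p) (hR : 8 ≤ p * R) {U : Finset α}
    (r : ℕ) (hr : r * p ≤ 1) {A : Finset ι} {F : ι → Finset α}
    (hU : ∀ i ∈ A, F i ⊆ U) (hk : ∀ i ∈ A, (F i).card < 2 ^ r)
    (hsp : ∀ X : Finset α, ((A.filter fun i => X ⊆ F i).card : ℝ) * R ^ X.card ≤ N) :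
    (A.card : ℝ) * biasedMean (r * p) U (avoids A F) ≤
      2 * (4 / (p * R)) * (1 - (1 / 2) ^ r) * N := by
  induction r generalizing A F with
  | zero =>
    rcases A.eq_empty_or_nonempty with rfl | ⟨i, hi⟩
    · simp
    · have : avoids A F = fun _ => 0 := by
        ext W
        have hF : F i = ∅ := by simpa using hk i hi
        exact if_pos ⟨i, hi, by simp [hF]⟩
      rw [this, biasedMean_const]
      simp
  | succ r ih =>
    push_cast at hr
    have hrp : 0 ≤ r * p := by positivity
    have h1 : p ≤ 1 := by linarith
    have hR0 : 0 < R := by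
      by_contra h
      nlinarith
    have hN : 0 ≤ N := by
      have := hsp ∅
      simp only [Finset.empty_subset, Finset.card_empty, pow_zero, mul_one] at this
      exact le_trans (by positivity) this
    obtain ⟨g, hg⟩ := exists_minimal_fragment A F
    have hTi : ∀ W, ∀ i ∈ A, F (g W i) \ W ⊆ F i := by
      intro W i hi x hx
      rw [Finset.mem_sdiff] at hx
      rcases Finset.mem_union.1 ((hg W i hi).2.1 hx.1) with h | h
      · exact h
      · exact absurd h hx.2
    have hbig := biasedMean_card_large_fragment_le (j := 2 ^ r) h0 h1 (by linarith) hU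
      (fun i hi => (hk i hi).le) hsp hg
    set x := 4 / (p * R) with hx
    have hx0 : 0 ≤ x := by positivity
    have hx2 : x ≤ 1 / 2 := by
      rw [hx, div_le_iff₀ (by positivity)]
      linarith
    have hstep : ∀ W ⊆ U, (A.card : ℝ) * biasedMean (r * p) U (fun V => avoids A F (W ∪ V)) ≤
        2 * x * (1 - (1 / 2) ^ r) * N +
          ((A.filter fun i => 2 ^ r ≤ (F (g W i) \ W).card).card : ℝ) := by
      intro W _
      set B := A.filter fun i => ¬ 2 ^ r ≤ (F (g W i) \ W).card with hB
      have hcard : (A.card : ℝ) =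
          ((A.filter fun i => 2 ^ r ≤ (F (g W i) \ W).card).card : ℝ) + B.card := by
        rw [hB, ← Nat.cast_add, Finset.card_filter_add_card_filter_not]
      -- The small fragments form an indexed family, possibly with repetitions. `N` stays fixed
      -- although indices are lost.
      have hIH := ih (by linarith) (A := B) (F := fun i => F (g W i) \ W)
        (fun i hi => Finset.sdiff_subset.trans (hU _ (hg W i (Finset.mem_filter.1 hi).1).1))
        (fun i hi => not_le.1 (Finset.mem_filter.1 hi).2)
        (fun X => by
          refine le_trans (mul_le_mul_of_nonneg_right ?_ (by positivity)) (hsp X)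
          rw [Nat.cast_le]
          refine Finset.card_le_card fun i hi => ?_
          rw [Finset.mem_filter] at hi ⊢
          have hiA := (Finset.mem_filter.1 hi.1).1
          exact ⟨hiA, hi.2.trans (hTi W i hiA)⟩)
      have hle : biasedMean (r * p) U (fun V => avoids A F (W ∪ V)) ≤
          biasedMean (r * p) U (avoids B fun i => F (g W i) \ W) := by
        refine biasedMean_mono hrp (by linarith) fun V _ => ?_
        by_cases hV : ∃ i ∈ B, F (g W i) \ W ⊆ V
        · obtain ⟨i, hi, hiV⟩ := hV
          have : avoids A F (W ∪ V) = 0 :=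
            if_pos ⟨g W i, (hg W i (Finset.mem_filter.1 hi).1).1, sdiff_le_iff.1 hiV⟩
          rw [this]
          exact avoids_nonneg _ _ _
        · have : avoids B (fun i => F (g W i) \ W) V = 1 := if_neg hV
          rw [this]
          exact avoids_le_one _ _ _
      have hle1 : biasedMean (r * p) U (fun V => avoids A F (W ∪ V)) ≤ 1 := by
        rw [← biasedMean_const (r * p) 1 U]
        exact biasedMean_mono hrp (by linarith) fun V _ => avoids_le_one _ _ _
      rw [hcard, add_mul, add_comm]
      refine add_le_add ((mul_le_mul_of_nonneg_left hle (by positivity)).trans hIH) ?_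
      exact mul_le_of_le_one_right (by positivity) hle1
    -- With size bound `2 ^ (r + 1)` and threshold `2 ^ r`, the loss is `x ^ 2 ^ r`; the losses sum
    -- to at most a geometric series.
    have hpow : (2 : ℝ) ^ 2 ^ (r + 1) * ((p * R) ^ 2 ^ r)⁻¹ ≤ x * (1 / 2) ^ r := by
      have h3 : (2 : ℝ) ^ 2 ^ (r + 1) * ((p * R) ^ 2 ^ r)⁻¹ = x ^ 2 ^ r := by
        rw [hx, div_pow, pow_succ 2 r, mul_comm (2 ^ r) 2, pow_mul]
        norm_num [div_eq_mul_inv]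
      rw [h3]
      calc x ^ 2 ^ r ≤ x ^ (r + 1) :=
            pow_le_pow_of_le_one hx0 (by linarith) Nat.lt_two_pow_self
        _ = x * x ^ r := by ring
        _ ≤ x * (1 / 2) ^ r :=
            mul_le_mul_of_nonneg_left (pow_le_pow_left₀ hx0 hx2 r) hx0
    calc (A.card : ℝ) * biasedMean ((r + 1 : ℕ) * p) U (avoids A F)
        ≤ A.card * biasedMean p U fun W =>
            biasedMean (r * p) U fun V => avoids A F (W ∪ V) := by
          refine mul_le_mul_of_nonneg_left ?_ (by positivity)
          have : ((r + 1 : ℕ) : ℝ) * p = p + r * p := by push_cast; ring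
          rw [this]
          exact biasedMean_add_le_union h0.le hrp (by linarith) U (antitone_avoids A F)
      _ ≤ 2 * x * (1 - (1 / 2) ^ r) * N + x * (1 / 2) ^ r * N := by
          rw [← biasedMean_mul_left]
          refine (biasedMean_mono h0.le h1 hstep).trans ?_
          rw [biasedMean_add, biasedMean_const]
          exact add_le_add le_rfl (hbig.trans (mul_le_mul_of_nonneg_right hpow hN))
      _ = _ := by ring

end Fragments

/-! ### Random partitions versus independent sets -/

section NegativeAssociation

/-- For uniform `d`, at most one factor drops to its smaller value, so the factors are negatively
correlated: the mean of the product is at most the product of the means. -/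
theorem sum_prod_ite_le {κ : Type*} [Fintype κ] [DecidableEq κ] {a b : κ → ℝ} {p : ℝ}
    (hp : p * Fintype.card κ = 1) (hb : ∀ c, 0 ≤ b c) (hab : ∀ c, b c ≤ a c) (D : Finset κ) :
    ∑ d, ∏ c ∈ D, (if c = d then b c else a c) ≤
      Fintype.card κ * ∏ c ∈ D, (p * b c + (1 - p) * a c) := by
  have hq : (0 : ℝ) ≤ Fintype.card κ := by positivity
  have hp0 : 0 ≤ p := by
    by_contra h
    nlinarith
  have hp1 : p ≤ 1 := by
    have : (1 : ℝ) ≤ Fintype.card κ := by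
      rcases Nat.eq_zero_or_pos (Fintype.card κ) with h | h
      · simp [h] at hp
      · exact_mod_cast h
    nlinarith
  have h1p : 0 ≤ 1 - p := by linarith
  have hy : ∀ c, 0 ≤ p * b c + (1 - p) * a c := fun c =>
    add_nonneg (mul_nonneg hp0 (hb c)) (mul_nonneg h1p ((hb c).trans (hab c)))
  induction D using Finset.induction_on with
  | empty => simp
  | insert e D he ih =>
    have h1 : ∑ d, ∏ c ∈ insert e D, (if c = d then b c else a c) =
        a e * (∑ d, ∏ c ∈ D, (if c = d then b c else a c)) - (a e - b e) * ∏ c ∈ D, a c := by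
      have h2 : ∀ d, ∏ c ∈ insert e D, (if c = d then b c else a c) =
          a e * (∏ c ∈ D, (if c = d then b c else a c)) -
            if e = d then (a e - b e) * ∏ c ∈ D, a c else 0 := by
        intro d
        rw [Finset.prod_insert he]
        by_cases hd : e = d
        · subst hd
          have : ∏ c ∈ D, (if c = e then b c else a c) = ∏ c ∈ D, a c :=
            Finset.prod_congr rfl fun c hc => if_neg (ne_of_mem_of_not_mem hc he)
          rw [this]
          simp only [if_true]
          ring
        · simp [hd]
      simp_rw [h2]
      rw [Finset.sum_sub_distrib, ← Finset.mul_sum]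
      simp
    have h3 : ∏ c ∈ D, (p * b c + (1 - p) * a c) ≤ ∏ c ∈ D, a c :=
      Finset.prod_le_prod (fun c _ => hy c) fun c _ => by nlinarith [hab c]
    rw [h1, Finset.prod_insert he]
    have hae := (hb e).trans (hab e)
    have h4 := mul_le_mul_of_nonneg_left ih hae
    have h5 := mul_le_mul_of_nonneg_left h3 (sub_nonneg.2 (hab e))
    set P := ∏ c ∈ D, (p * b c + (1 - p) * a c)
    have h6 : (Fintype.card κ : ℝ) * ((p * b e + (1 - p) * a e) * P) =
        a e * (Fintype.card κ * P) - p * Fintype.card κ * ((a e - b e) * P) := by ring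
    rw [h6, hp]
    linarith

/-- The parts of a random partition behave, for products of antitone functions, no worse than
independent random sets. -/
theorem exists_disjoint_sum_prod_le {α κ J : Type*} [DecidableEq α] [Fintype κ] [DecidableEq κ]
    {p : ℝ} (hp : p * Fintype.card κ = 1) (hp0 : 0 ≤ p) (hp1 : p ≤ 1) (I : Finset J)
    (D : J → Finset κ) (U : Finset α) (φ : J → Finset α → ℝ) (hφ : ∀ t, Antitone (φ t))
    (hφ0 : ∀ t W, 0 ≤ φ t W) :
    ∃ V : κ → Finset α, (∀ c, V c ⊆ U) ∧ (∀ c d, c ≠ d → Disjoint (V c) (V d)) ∧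
      ∑ t ∈ I, ∏ c ∈ D t, φ t (V c) ≤ ∑ t ∈ I, ∏ _c ∈ D t, biasedMean p U (φ t) := by
  induction U using Finset.induction_on generalizing φ with
  | empty => exact ⟨fun _ => ∅, by simp, by simp, by simp [biasedMean_empty]⟩
  | insert e U he ih =>
    have h1p : 0 ≤ 1 - p := by linarith
    obtain ⟨V, hVU, hVd, hV⟩ := ih (fun t W => p * φ t (insert e W) + (1 - p) * φ t W)
      (fun t => antitone_mix hp0 hp1 (hφ t) e)
      (fun t W => add_nonneg (mul_nonneg hp0 (hφ0 _ _)) (mul_nonneg h1p (hφ0 _ _)))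
    simp_rw [biasedMean_insert p he]
    have heV : ∀ c, e ∉ V c := fun c h => he (hVU c h)
    let V' : κ → κ → Finset α := fun d c => if c = d then insert e (V c) else V c
    -- Averaging over the part that receives `e` shows that some choice does no worse than the mean.
    obtain ⟨d, hd⟩ : ∃ d, ∑ t ∈ I, ∏ c ∈ D t, φ t (V' d c) ≤
        ∑ t ∈ I, ∏ c ∈ D t, (p * φ t (insert e (V c)) + (1 - p) * φ t (V c)) := by
      have hne : (Finset.univ : Finset κ).Nonempty := by
        rw [← Finset.card_pos, Finset.card_univ]
        rcases Nat.eq_zero_or_pos (Fintype.card κ) with h | h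
        · simp [h] at hp
        · exact h
      obtain ⟨d, -, hd⟩ := Finset.exists_le_of_sum_le (s := (Finset.univ : Finset κ))
        (f := fun d => ∑ t ∈ I, ∏ c ∈ D t, φ t (V' d c))
        (g := fun _ => ∑ t ∈ I, ∏ c ∈ D t, (p * φ t (insert e (V c)) + (1 - p) * φ t (V c)))
        hne (by
          rw [Finset.sum_comm, Finset.sum_const, Finset.card_univ, nsmul_eq_mul, Finset.mul_sum]
          refine Finset.sum_le_sum fun t _ => ?_
          refine le_trans (le_of_eq ?_) (sum_prod_ite_le hp (fun c => hφ0 t (insert e (V c)))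
            (fun c => hφ t (Finset.subset_insert e (V c))) (D t))
          refine Finset.sum_congr rfl fun d _ => Finset.prod_congr rfl fun c _ => ?_
          simp only [V']
          split_ifs <;> rfl)
      exact ⟨d, hd⟩
    refine ⟨V' d, fun c => ?_, fun c c' hcc => ?_, hd.trans hV⟩
    · simp only [V']
      split_ifs
      · exact Finset.insert_subset_insert e (hVU c)
      · exact (hVU c).trans (Finset.subset_insert e U)
    · simp only [V']
      split_ifs with h h'
      · exact absurd (h.trans h'.symm) hcc
      · exact Finset.disjoint_insert_left.2 ⟨heV c', hVd c c' hcc⟩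
      · exact Finset.disjoint_insert_right.2 ⟨heV c, hVd c c' hcc⟩
      · exact hVd c c' hcc

end NegativeAssociation

/-! ### Disjoint representatives -/

/-- Families that a random set of density `1 / (2 * s)` rarely avoids have disjoint
representatives. -/
theorem exists_disjoint_of_biasedMean_avoids_le {α : Type*} [DecidableEq α] {s : ℕ} (hs : 0 < s)
    (U : Finset α) (G : Fin s → Finset (Finset α))
    (hG : ∀ i, biasedMean (1 / (2 * s)) U (avoids (G i) id) ≤ 1 / 8) :
    ∃ F : Fin s → Finset α, (∀ i, F i ∈ G i) ∧ ∀ i j, i ≠ j → Disjoint (F i) (F j) := by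
  classical
  have hs1 : (1 : ℝ) ≤ s := by exact_mod_cast hs
  have hp0 : (0 : ℝ) ≤ 1 / (2 * s) := by positivity
  have hp1 : (1 : ℝ) / (2 * s) ≤ 1 := by
    rw [div_le_iff₀ (by positivity)]
    linarith
  obtain ⟨V, -, hVd, hV⟩ := exists_disjoint_sum_prod_le (κ := Fin (2 * s)) (p := 1 / (2 * s))
    (by rw [Fintype.card_fin]; push_cast; field_simp) hp0 hp1
    ((Finset.univ : Finset (Fin s)) ×ˢ Finset.powersetCard (s + 1) Finset.univ)
    (fun t => t.2) U (fun t => avoids (G t.1) id) (fun t => antitone_avoids _ _)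
    (fun t => avoids_nonneg _ _)
  have hlt : ∑ t ∈ (Finset.univ : Finset (Fin s)) ×ˢ
      Finset.powersetCard (s + 1) (Finset.univ : Finset (Fin (2 * s))),
      ∏ c ∈ t.2, avoids (G t.1) id (V c) < 1 := by
    refine hV.trans_lt ?_
    calc _ ≤ ∑ t ∈ (Finset.univ : Finset (Fin s)) ×ˢ
          Finset.powersetCard (s + 1) (Finset.univ : Finset (Fin (2 * s))),
          ((1 : ℝ) / 8) ^ (s + 1) := by
          refine Finset.sum_le_sum fun t ht => ?_
          rw [Finset.prod_const, (Finset.mem_powersetCard.1 (Finset.mem_product.1 ht).2).2]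
          refine pow_le_pow_left₀ ?_ (hG t.1) _
          rw [← biasedMean_const (1 / (2 * (s : ℝ))) 0 U]
          exact biasedMean_mono hp0 hp1 fun W _ => avoids_nonneg _ _ _
      _ = s * ((2 * s).choose (s + 1) : ℝ) * (1 / 8) ^ (s + 1) := by
          rw [Finset.sum_const, nsmul_eq_mul, Finset.card_product, Finset.card_powersetCard]
          simp
      -- Here `2 ^ s * 4 ^ s` cancels `8 ^ s`, which is why `1 / 8` suffices.
      _ ≤ 2 ^ s * 2 ^ (2 * s) * (1 / 8) ^ (s + 1) := by
          have h1 : (s : ℝ) ≤ 2 ^ s := by exact_mod_cast Nat.lt_two_pow_self.le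
          have h2 : ((2 * s).choose (s + 1) : ℝ) ≤ 2 ^ (2 * s) := by
            exact_mod_cast Nat.choose_le_two_pow _ _
          gcongr
      _ = 1 / 8 := by
          rw [pow_succ, pow_mul, ← mul_pow, ← mul_assoc, ← mul_pow]
          norm_num
      _ < 1 := by norm_num
  let good : Fin s → Finset (Fin (2 * s)) :=
    fun i => Finset.univ.filter fun c => ∃ S ∈ G i, S ⊆ V c
  have hgood : ∀ i, s ≤ (good i).card := by
    intro i
    by_contra hcon
    have hbad : s + 1 ≤ (good i)ᶜ.card := by
      rw [Finset.card_compl, Fintype.card_fin]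
      omega
    obtain ⟨D, hD, hDc⟩ := Finset.exists_subset_card_eq hbad
    have h1 : ∏ c ∈ D, avoids (G i) id (V c) = 1 := by
      refine Finset.prod_eq_one fun c hc => if_neg fun h => ?_
      exact Finset.mem_compl.1 (hD hc) (Finset.mem_filter.2 ⟨Finset.mem_univ _, h⟩)
    have h2 := Finset.single_le_sum
      (f := fun t : Fin s × Finset (Fin (2 * s)) => ∏ c ∈ t.2, avoids (G t.1) id (V c))
      (fun t _ => Finset.prod_nonneg fun c _ => avoids_nonneg _ _ _)
      (Finset.mem_product (p := (i, D)).2 ⟨Finset.mem_univ i,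
        Finset.mem_powersetCard.2 ⟨Finset.subset_univ D, hDc⟩⟩)
    simp only [h1] at h2
    linarith
  obtain ⟨f, hf, hfg⟩ := (Finset.all_card_le_biUnion_card_iff_exists_injective good).1 (by
    intro I
    rcases I.eq_empty_or_nonempty with rfl | ⟨i, hi⟩
    · simp
    · calc I.card ≤ s := by simpa using I.card_le_univ
        _ ≤ (good i).card := hgood i
        _ ≤ _ := Finset.card_le_card (Finset.subset_biUnion_of_mem good hi))
  have hF : ∀ i, ∃ S ∈ G i, S ⊆ V (f i) := fun i => (Finset.mem_filter.1 (hfg i)).2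
  choose F hFG hFV using hF
  exact ⟨F, hFG, fun i j hij => (hVd _ _ (hf.ne hij)).mono (hFV i) (hFV j)⟩

theorem card_linkFamily {n : ℕ} (𝓕 : Finset (Finset (Fin n))) (X : Finset (Fin n)) :
    (linkFamily 𝓕 X).card = (𝓕.filter fun F => X ⊆ F).card := by
  have h : (𝓕.filter fun F => F ∩ X = X) = 𝓕.filter fun F => X ⊆ F :=
    Finset.filter_congr fun F _ => Finset.inter_eq_right
  rw [linkFamily, restrictFamily, h]
  refine Finset.card_image_of_injOn fun A hA B hB hAB => ?_
  have hA' := (Finset.mem_filter.1 (Finset.mem_coe.1 hA)).2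
  have hB' := (Finset.mem_filter.1 (Finset.mem_coe.1 hB)).2
  rw [← Finset.sdiff_union_of_subset hA', ← Finset.sdiff_union_of_subset hB']
  exact congrArg (· ∪ X) hAB

theorem biasedMean_avoids_le_of_isSpreadFamily {n r : ℕ} {p R : ℝ} (h0 : 0 < p)
    (hR : 64 ≤ p * R) (hr : r * p ≤ 1) {𝓕 : Finset (Finset (Fin n))} (hsp : IsSpreadFamily R 𝓕)
    (hk : ∀ F ∈ 𝓕, F.card < 2 ^ r) :
    biasedMean (r * p) Finset.univ (avoids 𝓕 id) ≤ 1 / 8 := by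
  have hR0 : 0 < R := by
    by_contra h
    nlinarith
  have hc : (0 : ℝ) < 𝓕.card := by exact_mod_cast hsp.1.card_pos
  have h := card_mul_biasedMean_avoids_le (N := 𝓕.card) h0 (by linarith) r hr (A := 𝓕) (F := id)
    (fun F _ => Finset.subset_univ F) hk (fun X => by
      have hX := hsp.2 X
      rw [card_linkFamily, zpow_neg, zpow_natCast] at hX
      calc _ ≤ (R ^ X.card)⁻¹ * 𝓕.card * R ^ X.card :=
            mul_le_mul_of_nonneg_right hX (by positivity)
        _ = 𝓕.card := by field_simp)
  have hx : 4 / (p * R) ≤ 1 / 16 := by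
    rw [div_le_iff₀ (by positivity)]
    linarith
  have hx0 : 0 ≤ 4 / (p * R) := by positivity
  have hh : (0 : ℝ) ≤ (1 / 2) ^ r := by positivity
  have h2 : 2 * (4 / (p * R)) * (1 - (1 / 2) ^ r) ≤ 1 / 8 := by nlinarith
  have h3 := h.trans (mul_le_mul_of_nonneg_right h2 hc.le)
  rw [mul_comm] at h3
  exact le_of_mul_le_mul_right h3 hc

theorem mainTheorem9 (n s k : ℕ) (hk : 2 ≤ k) (R : ℝ)
    (hR : (2 : ℝ) ^ 13 * (s : ℝ) * ((⌈Real.logb 2 (k : ℝ)⌉ : ℤ) : ℝ) < R)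
    (G : Fin s → Finset (Finset (Fin n)))
    (hunif : ∀ i, ∃ l : ℕ, l ≤ k ∧ IsUniformFamily l (G i))
    (hspread : ∀ i, IsSpreadFamily R (G i)) :
    ∃ F : Fin s → Finset (Fin n),
      (∀ i, F i ∈ G i) ∧ ∀ i j, i ≠ j → Disjoint (F i) (F j) := by
  rcases Nat.eq_zero_or_pos s with rfl | hs
  · exact ⟨fun i => i.elim0, fun i => i.elim0, fun i => i.elim0⟩
  have hk2 : (2 : ℝ) ≤ k := by exact_mod_cast hk
  have hlog : 1 ≤ Real.logb 2 k := by
    rw [Real.le_logb_iff_rpow_le (by norm_num) (by linarith)]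
    simpa using hk2
  obtain ⟨m, hm⟩ : ∃ m : ℕ, ⌈Real.logb 2 (k : ℝ)⌉ = m :=
    Int.eq_ofNat_of_zero_le (Int.ceil_nonneg (by linarith))
  have hlm : Real.logb 2 k ≤ m := by
    have := Int.le_ceil (Real.logb 2 (k : ℝ))
    rw [hm] at this
    exact_mod_cast this
  have hm1 : (1 : ℝ) ≤ m := hlog.trans hlm
  have hkm : k ≤ 2 ^ m := by
    rw [Real.logb_le_iff_le_rpow (by norm_num) (by linarith), Real.rpow_natCast] at hlm
    exact_mod_cast hlm
  rw [hm, Int.cast_natCast] at hR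
  have hs1 : (1 : ℝ) ≤ s := by exact_mod_cast hs
  refine exists_disjoint_of_biasedMean_avoids_le hs Finset.univ G fun i => ?_
  obtain ⟨l, hl, hul⟩ := hunif i
  -- There are `m + 1` rounds rather than `m`, since set sizes may equal `2 ^ m` and the spread
  -- lemma needs a strict bound.
  have hrp : ((m + 1 : ℕ) : ℝ) * (1 / (2 * s * (m + 1))) = 1 / (2 * s) := by
    push_cast
    field_simp
  rw [← hrp]
  refine biasedMean_avoids_le_of_isSpreadFamily (R := R) (by positivity) ?_ ?_ (hspread i) ?_
  -- As `m + 1 ≤ 2 * m`, the ratio `R / (2 * s * (m + 1))` exceeds `2 ^ 11`, far above `64`.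
  · rw [one_div_mul_eq_div, le_div_iff₀ (by positivity)]
    have : (1 : ℝ) ≤ s * m := by nlinarith
    nlinarith
  · rw [hrp, div_le_iff₀ (by positivity)]
    linarith
  · intro S hS
    rw [hul S hS]
    calc l ≤ 2 ^ m := hl.trans hkm
      _ < 2 ^ (m + 1) := Nat.pow_lt_pow_right (by norm_num) (Nat.lt_succ_self m)
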